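/- Conventions. Let $G$ be a locally compact (Hausdorff) group that is compactly generated, i.e. generated by some compact subset $S$, and let $|\cdot|_S$ and $d_S(g,h)=|g^{-1}h|_S$ be the word length and word metric of $S$. Given a sequence $\mathbf s=(s_n)$ of positive reals tending to infinity and a non-principal ultrafilter $\omega$ on $\mathbb N$, the asymptotic cone $\mathrm{Cone}^\omega(G,d_S,\mathbf s)$ is the set of sequences $(g_n)$ in $G$ for which there is $C>0$ with $|g_n|_S\le C s_n$ for all $n$, modulo the relation $d_\omega=0$, with the metric $d_\omega((g_n),(h_n))=\lim^\omega d_S(g_n,h_n)/s_n$. The group $G$ is called lacunary hyperbolic if one of its asymptotic cones is a real tree (a geodesic $0$-hyperbolic metric space). A measurable subgroup $H\le G$ has relative exponential growth in $G$ if, for some compact generating set $S$ of $G$ and some left Haar measure $\mu$ on $G$, there is $\rho>1$ with $\mu(\{h\in H : |h|_S\le n\})\ge\rho^n$ for every $n\ge 1$. A group $\Gamma$ satisfies a law if there are $k$ and a non-trivial reduced word $w(x_1,\dots,x_k)$ such that $w(g_1,\dots,g_k)=1$ for all $g_1,\dots,g_k\in\Gamma$. Theorem. Let $G$ be a unimodular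 lacunary hyperbolic locally compact group and let $H\le G$ be a subgroup that is compactly generated (for the subspace topology) and has relative exponential growth in $G$. Assume that $H$ has no discrete subgroup $Z\cong\mathbb Z$ that is cocompact in $H$ (i.e. with $H/Z$ compact). Then $H$ does not satisfy a law. -/

import Mathlib

open Filter Topology MeasureTheory
open scoped Pointwise

noncomputable section

namespace LacunaryHyp

/-! ### Geodesic spaces, hyperbolicity, real trees -/

/-- `A` is (the image of) a geodesic segment of `X` from `x` to `y`. -/
def IsGeodesicSegment {X : Type*} [MetricSpace X] (x y : X) (A : Set X) : Prop :=
  ∃ γ : ℝ → X, γ 0 = x ∧ γ (dist x y) = y ∧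
    (∀ t ∈ Set.Icc 0 (dist x y), ∀ u ∈ Set.Icc 0 (dist x y), dist (γ t) (γ u) = |t - u|) ∧
    A = γ '' Set.Icc 0 (dist x y)

/-- Any two points are joined by a geodesic segment. -/
def IsGeodesicSpace (X : Type*) [MetricSpace X] : Prop :=
  ∀ x y : X, ∃ A : Set X, IsGeodesicSegment x y A

/-- Any side of any geodesic triangle lies in the closed `δ`-neighbourhood of the union of the two
other sides. -/
def HasThinTriangles (X : Type*) [MetricSpace X] (δ : ℝ) : Prop :=
  ∀ (x y z : X) (A B C : Set X),
    IsGeodesicSegment x y A → IsGeodesicSegment y z B → IsGeodesicSegment z x C →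
    ∀ p ∈ A, ∃ q ∈ B ∪ C, dist p q ≤ δ

/-- A real tree: a geodesic `0`-hyperbolic metric space. -/
def IsRealTree (X : Type*) [MetricSpace X] : Prop :=
  IsGeodesicSpace X ∧ HasThinTriangles X 0

/-! ### Asymptotic cones -/

/-- A scaling sequence: positive real numbers tending to infinity. -/
structure ScalingSequence where
  /-- The underlying sequence. -/
  seq : ℕ → ℝ
  pos : ∀ n, 0 < seq n
  tendsto : Tendsto seq atTop atTop

/-- The ultrafilter `ω` on `ℕ` is non-principal: it contains no singleton. -/
def IsNonPrincipal (ω : Ultrafilter ℕ) : Prop :=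
  ∀ n : ℕ, ({n} : Set ℕ) ∉ ω

/-- The `s`-linear sequences of points of `X` (with respect to the base point `e`). The ultrafilter
`ω` only enters in the pseudometric put on this set below. -/
def Precone (X : Type*) [MetricSpace X] (e : X) (s : ScalingSequence) (_ω : Ultrafilter ℕ) :
    Type _ :=
  {x : ℕ → X // ∃ C : ℝ, 0 < C ∧ ∀ n, dist (x n) e ≤ C * s.seq n}

section Precone

variable {X : Type*} [MetricSpace X] {e : X} {s : ScalingSequence} {ω : Ultrafilter ℕ}

/-- `d_ω(x, y)`, the limit of `d(x_n, y_n) / s_n` along `ω`. -/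
def ultraDist (x y : Precone X e s ω) : ℝ :=
  limUnder (ω : Filter ℕ) (fun n => dist (x.1 n) (y.1 n) / s.seq n)

/-- The limit defining `d_ω` exists. -/
theorem tendsto_ultraDist (x y : Precone X e s ω) :
    Tendsto (fun n => dist (x.1 n) (y.1 n) / s.seq n) ω (𝓝 (ultraDist x y)) := by
  obtain ⟨C, _, hC⟩ := x.2
  obtain ⟨D, _, hD⟩ := y.2
  have hmem : ∀ n, dist (x.1 n) (y.1 n) / s.seq n ∈ Set.Icc (0 : ℝ) (C + D) := by
    intro n
    have hs := s.pos n
    refine ⟨by positivity, ?_⟩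
    rw [div_le_iff₀ hs]
    have := dist_triangle_right (x.1 n) (y.1 n) e
    have h1 := hC n
    have h2 := hD n
    linarith
  obtain ⟨l, _, hl⟩ := (isCompact_Icc (a := (0 : ℝ)) (b := C + D)).ultrafilter_le_nhds
    (ω.map (fun n => dist (x.1 n) (y.1 n) / s.seq n))
    (by
      rw [Filter.le_principal_iff]
      exact Filter.mem_map.2 (Filter.Eventually.of_forall hmem))
  exact tendsto_nhds_limUnder ⟨l, hl⟩

/-- `d_ω` is a pseudometric on the set of `s`-linear sequences. -/
instance : PseudoMetricSpace (Precone X e s ω) where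
  dist := ultraDist
  dist_self x := by
    refine tendsto_nhds_unique (tendsto_ultraDist x x) ?_
    simp
  dist_comm x y := by
    refine tendsto_nhds_unique (tendsto_ultraDist x y) ?_
    simpa only [dist_comm] using tendsto_ultraDist y x
  dist_triangle x y z := by
    refine le_of_tendsto_of_tendsto' (tendsto_ultraDist x z)
      ((tendsto_ultraDist x y).add (tendsto_ultraDist y z)) fun n => ?_
    rw [← add_div]
    exact div_le_div_of_nonneg_right (dist_triangle _ _ _) (s.pos n).le

end Precone

/-- The asymptotic cone of `X`: the `s`-linear sequences modulo being at `d_ω`-distance zero, with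
the metric induced by `d_ω`. -/
abbrev AsymptoticCone (X : Type*) [MetricSpace X] (e : X) (s : ScalingSequence)
    (ω : Ultrafilter ℕ) : Type _ :=
  SeparationQuotient (Precone X e s ω)

/-! ### Word metrics -/

section Word

variable {G : Type*} [Group G]

/-- The word length with respect to `S`: the least `n` such that `g` is a product of `n` elements
of `S ∪ S⁻¹`. It is only used when `S` generates `G`. -/
def wordLength (S : Set G) (g : G) : ℕ :=
  sInf {n : ℕ | g ∈ (S ∪ S⁻¹) ^ n}

/-- The closed ball of radius `n` around the identity in the word metric of `S`. -/
def wordBall (S : Set G) (n : ℕ) : Set G :=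
  {g : G | wordLength S g ≤ n}

theorem exists_mem_pow {S : Set G} (hS : Subgroup.closure S = ⊤) (g : G) :
    ∃ n : ℕ, g ∈ (S ∪ S⁻¹) ^ n := by
  have hg : g ∈ Submonoid.closure (S ∪ S⁻¹) := by
    rw [← Subgroup.closure_toSubmonoid, hS]
    trivial
  induction hg using Submonoid.closure_induction with
  | mem x hx => exact ⟨1, by simpa using hx⟩
  | one => exact ⟨0, by simp⟩
  | mul x y _ _ hx hy =>
    obtain ⟨m, hm⟩ := hx
    obtain ⟨n, hn⟩ := hy
    exact ⟨m + n, by rw [pow_add]; exact Set.mul_mem_mul hm hn⟩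

theorem mem_pow_wordLength {S : Set G} (hS : Subgroup.closure S = ⊤) (g : G) :
    g ∈ (S ∪ S⁻¹) ^ wordLength S g :=
  Nat.sInf_mem (exists_mem_pow hS g)

theorem wordLength_le {S : Set G} {g : G} {n : ℕ} (h : g ∈ (S ∪ S⁻¹) ^ n) :
    wordLength S g ≤ n :=
  Nat.sInf_le h

theorem wordLength_one (S : Set G) : wordLength S (1 : G) = 0 :=
  Nat.le_zero.1 (wordLength_le (by simp))

theorem wordLength_inv_le {S : Set G} (hS : Subgroup.closure S = ⊤) (g : G) :
    wordLength S g⁻¹ ≤ wordLength S g := by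
  refine wordLength_le ?_
  have h := Set.inv_mem_inv.2 (mem_pow_wordLength hS g)
  rwa [← inv_pow, Set.union_inv, inv_inv, Set.union_comm] at h

theorem wordLength_mul_le {S : Set G} (hS : Subgroup.closure S = ⊤) (g h : G) :
    wordLength S (g * h) ≤ wordLength S g + wordLength S h := by
  refine wordLength_le ?_
  rw [pow_add]
  exact Set.mul_mem_mul (mem_pow_wordLength hS g) (mem_pow_wordLength hS h)

/-- The word metric `d_S(g, h) = |g⁻¹ h|_S`. -/
def wordDist (S : Set G) (g h : G) : ℝ := (wordLength S (g⁻¹ * h) : ℝ)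

theorem wordDist_self (S : Set G) (g : G) : wordDist S g g = 0 := by
  simp [wordDist, wordLength_one]

theorem wordDist_comm {S : Set G} (hS : Subgroup.closure S = ⊤) (g h : G) :
    wordDist S g h = wordDist S h g := by
  have key : ∀ a b : G, wordLength S (a⁻¹ * b) ≤ wordLength S (b⁻¹ * a) := fun a b => by
    simpa using wordLength_inv_le hS (b⁻¹ * a)
  exact congrArg (Nat.cast (R := ℝ)) (le_antisymm (key g h) (key h g))

theorem wordDist_triangle {S : Set G} (hS : Subgroup.closure S = ⊤) (g h k : G) :
    wordDist S g k ≤ wordDist S g h + wordDist S h k := by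
  have key : wordLength S (g⁻¹ * k) ≤ wordLength S (g⁻¹ * h) + wordLength S (h⁻¹ * k) := by
    simpa [mul_assoc] using wordLength_mul_le hS (g⁻¹ * h) (h⁻¹ * k)
  unfold wordDist
  exact_mod_cast key

theorem eq_of_wordDist_eq_zero {S : Set G} (hS : Subgroup.closure S = ⊤) {g h : G}
    (hgh : wordDist S g h = 0) : g = h := by
  have h0 : wordLength S (g⁻¹ * h) = 0 := by
    unfold wordDist at hgh
    exact_mod_cast hgh
  have := mem_pow_wordLength hS (g⁻¹ * h)
  rw [h0, pow_zero, Set.mem_one] at this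
  exact inv_mul_eq_one.1 this

/-- The group `G`, viewed as a metric space for the word metric of a generating set `S`. -/
def WordSpace (S : Set G) (_hS : Subgroup.closure S = ⊤) : Type _ := G

/-- The identity element, as a point of `G` with its word metric. -/
def WordSpace.base (S : Set G) (hS : Subgroup.closure S = ⊤) : WordSpace S hS := (1 : G)

instance (S : Set G) (hS : Subgroup.closure S = ⊤) : MetricSpace (WordSpace S hS) where
  dist := wordDist (G := G) S
  dist_self := wordDist_self (G := G) S
  dist_comm := wordDist_comm (G := G) hS
  dist_triangle := wordDist_triangle (G := G) hS
  eq_of_dist_eq_zero := eq_of_wordDist_eq_zero (G := G) hS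

end Word

/-! ### Group-theoretic notions of the statement -/

/-- `S` is a compact generating subset of `G`. -/
structure IsCompactGenerating {G : Type*} [Group G] [TopologicalSpace G] (S : Set G) : Prop where
  isCompact : IsCompact S
  closure_eq : Subgroup.closure S = ⊤

/-- The topological group `G` is compactly generated. -/
def IsCompactlyGenerated (G : Type*) [Group G] [TopologicalSpace G] : Prop :=
  ∃ S : Set G, IsCompactGenerating S

/-- A (locally compact) group is lacunary hyperbolic if it is compactly generated and one of its
asymptotic cones, taken with respect to the word metric of a compact generating subset, is a real
tree. -/
def IsLacunaryHyperbolic (G : Type*) [Group G] [TopologicalSpace G] : Prop :=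
  ∃ (S : Set G) (hS : IsCompactGenerating S) (s : ScalingSequence) (ω : Ultrafilter ℕ),
    IsNonPrincipal ω ∧
    IsRealTree
      (AsymptoticCone (WordSpace S hS.closure_eq) (WordSpace.base S hS.closure_eq) s ω)

/-- A locally compact group is unimodular if its modular function is trivial. -/
def IsUnimodular (G : Type*) [Group G] [TopologicalSpace G] [IsTopologicalGroup G]
    [LocallyCompactSpace G] : Prop :=
  ∀ g : G, Measure.modularCharacter g = 1

/-- The measurable subgroup `H` has relative exponential growth in `G`: for some compact generating
subset `S` of `G`, some left Haar measure `μ` on `G` and some `ρ > 1`, the intersection of `H` with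
the `n`-ball of `G` around the identity has measure at least `ρ ^ n`, for all `n ≥ 1`. -/
def HasRelativeExponentialGrowth {G : Type*} [Group G] [TopologicalSpace G]
    [MeasurableSpace G] [BorelSpace G] (H : Subgroup G) : Prop :=
  MeasurableSet (H : Set G) ∧
  ∃ (S : Set G) (μ : Measure G) (ρ : ℝ), IsCompactGenerating S ∧
    μ.IsHaarMeasure ∧ μ.Regular ∧ 1 < ρ ∧
    ∀ n : ℕ, 1 ≤ n → ENNReal.ofReal (ρ ^ n) ≤ μ ((H : Set G) ∩ wordBall S n)

/-- The topological group `H` has a discrete cocompact subgroup isomorphic to `ℤ`. -/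
def HasDiscreteCocompactZ (H : Type*) [Group H] [TopologicalSpace H] : Prop :=
  ∃ Z : Subgroup H, Nonempty (Z ≃* Multiplicative ℤ) ∧ DiscreteTopology Z ∧ CompactSpace (H ⧸ Z)

/-- The group `Γ` satisfies a law: there is a non-trivial reduced word `w(x₁, …, xₙ)` with
`w(g₁, …, gₙ) = 1` for all `g₁, …, gₙ` in `Γ`. -/
def SatisfiesLaw (Γ : Type*) [Group Γ] : Prop :=
  ∃ (n : ℕ) (w : FreeGroup (Fin n)), w ≠ 1 ∧ ∀ g : Fin n → Γ, FreeGroup.lift g w = 1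

end LacunaryHyp

end

/-!
Let a cone `X` of `G` be a real tree. The sequences in `H` of at most linear word length act on `X`
by isometries. As `G` is unimodular and `H` has relative exponential growth, a ball of `H` of radius
`t` is not covered by boundedly many two-sided translates of balls of `G` of radius `ε * t`; hence,
for any finite subsets `P` and `F` of `X`, some sequence in `H` moves the base point a bounded
distance and moves all of `P` away from `F`. Such an action cannot be by elliptic isometries only,
as it would then have almost fixed points. So some sequence `g` has an axis, and choosing
conjugators one after the other gives conjugates of a large power of `g` whose axes diverge early
on. By ping-pong these conjugates freely generate a free group of infinite rank. But a law of `H`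
would hold in every group of sequences in `H`.
-/

noncomputable section

namespace LacunaryHyp

universe u

/-! ### Gromov products -/

section Gromov

variable {X : Type*} [PseudoMetricSpace X]

/-- The Gromov product `(x | y)_o`; in a tree it is the distance from `o` to the segment
`[x, y]`. -/
def gromovProduct (o x y : X) : ℝ := (dist o x + dist o y - dist x y) / 2

/-- `0`-hyperbolicity in the sense of Gromov, by the four-point condition, which makes sense without
geodesics. -/
def IsZeroHyperbolic (X : Type*) [PseudoMetricSpace X] : Prop :=
  ∀ o x y z : X, min (gromovProduct o x y) (gromovProduct o y z) ≤ gromovProduct o x z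

/-- `m` is a midpoint of `x` and `y`. -/
def IsMidpoint (m x y : X) : Prop := dist x m = dist x y / 2 ∧ dist m y = dist x y / 2

/-- Any two points have a midpoint; this is all that is used of the geodesics of a real tree once it
is known to be `0`-hyperbolic. -/
def HasMidpoints (X : Type*) [PseudoMetricSpace X] : Prop :=
  ∀ x y : X, ∃ m : X, IsMidpoint m x y

theorem gromovProduct_comm (o x y : X) : gromovProduct o x y = gromovProduct o y x := by
  rw [gromovProduct, gromovProduct, dist_comm x y, add_comm]

theorem gromovProduct_self_right (o x : X) : gromovProduct o x x = dist o x := by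
  simp [gromovProduct]

theorem gromovProduct_nonneg (o x y : X) : 0 ≤ gromovProduct o x y := by
  unfold gromovProduct
  linarith [dist_triangle_left x y o]

theorem gromovProduct_eq_zero_iff {o x y : X} :
    gromovProduct o x y = 0 ↔ dist x o + dist o y = dist x y := by
  rw [gromovProduct, dist_comm x o, div_eq_zero_iff, or_iff_left two_ne_zero, sub_eq_zero]

theorem gromovProduct_le_add_dist (o x y x' y' : X) :
    gromovProduct o x y ≤ gromovProduct o x' y' + dist x x' + dist y y' := by
  unfold gromovProduct
  linarith [dist_triangle_right o x x', dist_triangle_right o y y', dist_triangle4 x' x y y',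
    dist_comm x' x]

theorem gromovProduct_le_add_dist_base (o o' x y : X) :
    gromovProduct o x y ≤ gromovProduct o' x y + dist o o' := by
  unfold gromovProduct
  linarith [dist_triangle o o' x, dist_triangle o o' y]

theorem IsMidpoint.symm {m x y : X} (h : IsMidpoint m x y) : IsMidpoint m y x := by
  rw [IsMidpoint, dist_comm y m, dist_comm m x, dist_comm y x]
  exact And.symm h

theorem IsMidpoint.gromovProduct_eq {m x y : X} (h : IsMidpoint m x y) :
    gromovProduct x m y = dist x y / 2 := by
  rw [gromovProduct, h.1, h.2]
  ring

theorem IsZeroHyperbolic.le_trans (hX : IsZeroHyperbolic X) {o x y z : X} {c : ℝ}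
    (hxy : c ≤ gromovProduct o x y) (hyz : c ≤ gromovProduct o y z) : c ≤ gromovProduct o x z :=
  (le_min hxy hyz).trans (hX o x y z)

theorem IsZeroHyperbolic.lt_trans (hX : IsZeroHyperbolic X) {o x y z : X} {c : ℝ}
    (hxy : c < gromovProduct o x y) (hyz : c < gromovProduct o y z) : c < gromovProduct o x z :=
  (lt_min hxy hyz).trans_le (hX o x y z)

theorem IsZeroHyperbolic.dist_midpoint_le (hX : IsZeroHyperbolic X) {o m m' x x' : X}
    (hm : IsMidpoint m o x) (hm' : IsMidpoint m' o x') (hle : dist o x ≤ dist o x')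
    (hxx' : dist o x / 2 ≤ gromovProduct o x x') : dist m m' ≤ (dist o x' - dist o x) / 2 := by
  have hx'm' : dist o x / 2 ≤ gromovProduct o x' m' := by
    rw [gromovProduct_comm, hm'.gromovProduct_eq]
    linarith
  have hmm' := hX.le_trans hm.gromovProduct_eq.ge (hX.le_trans hxx' hx'm')
  rw [gromovProduct, hm.1, hm'.1] at hmm'
  linarith

/-- Local geodesics are geodesics. -/
theorem IsZeroHyperbolic.dist_add_dist_of_overlap (hX : IsZeroHyperbolic X) {a b c d : X}
    (habc : dist a b + dist b c = dist a c) (hbcd : dist b c + dist c d = dist b d)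
    (hbc : 0 < dist b c) : dist a b + dist b d = dist a d := by
  rw [← gromovProduct_eq_zero_iff] at habc ⊢
  refine (gromovProduct_nonneg b a d).antisymm' (not_lt.1 fun had => ?_)
  have hdc : 0 < gromovProduct b d c := by
    unfold gromovProduct
    linarith [dist_comm c d]
  exact (hX.lt_trans had hdc).ne' habc

theorem IsZeroHyperbolic.totallyBounded_between (hX : IsZeroHyperbolic X) (p z : X) :
    TotallyBounded {y : X | dist p y + dist y z = dist p z} := by
  set A : Set X := {y : X | dist p y + dist y z = dist p z}
  have hA (y : A) : dist p y + dist (y : X) z = dist p z := y.2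
  have hiso : Isometry (fun y : A => dist p y) := by
    refine Isometry.of_dist_eq fun x y => ?_
    rw [Real.dist_eq, Subtype.dist_eq]
    apply le_antisymm
    · simpa [dist_comm] using abs_dist_sub_le (x : X) (y : X) p
    have hxzy := hX p x z y
    unfold gromovProduct at hxzy
    rw [le_abs]
    rcases min_le_iff.1 hxzy with h | h
    · right
      linarith [hA x]
    · left
      linarith [hA y, dist_comm z (y : X)]
  have huniv : TotallyBounded (Set.univ : Set A) :=
    (totallyBounded_preimage hiso.isUniformInducing (totallyBounded_Icc 0 (dist p z))).subset
      fun y _ => show dist p (y : X) ∈ Set.Icc 0 (dist p z) from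
        ⟨dist_nonneg, (le_add_of_nonneg_right dist_nonneg).trans_eq (hA y)⟩
  simpa using huniv.image uniformContinuous_subtype_val

end Gromov

/-! ### Real trees -/

section RealTree

variable {X : Type*} [MetricSpace X] {x y : X} {A : Set X}

theorem IsGeodesicSegment.dist_add_dist (hA : IsGeodesicSegment x y A) {p : X} (hp : p ∈ A) :
    dist x p + dist p y = dist x y := by
  obtain ⟨γ, h0, h1, hγ, rfl⟩ := hA
  obtain ⟨t, ht, rfl⟩ := hp
  have hxp := hγ 0 ⟨le_rfl, dist_nonneg⟩ t ht
  have hpy := hγ t ht _ ⟨dist_nonneg, le_rfl⟩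
  rw [h0, abs_of_nonpos (by linarith [ht.1])] at hxp
  rw [h1, abs_of_nonpos (by linarith [ht.2])] at hpy
  linarith

theorem IsGeodesicSegment.left_mem (hA : IsGeodesicSegment x y A) : x ∈ A := by
  obtain ⟨γ, h0, -, -, rfl⟩ := hA
  exact ⟨0, ⟨le_rfl, dist_nonneg⟩, h0⟩

theorem IsGeodesicSegment.right_mem (hA : IsGeodesicSegment x y A) : y ∈ A := by
  obtain ⟨γ, -, h1, -, rfl⟩ := hA
  exact ⟨_, ⟨dist_nonneg, le_rfl⟩, h1⟩

theorem IsGeodesicSegment.exists_continuousOn (hA : IsGeodesicSegment x y A) :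
    ∃ γ : ℝ → X, ContinuousOn γ (Set.Icc 0 (dist x y)) ∧ γ '' Set.Icc 0 (dist x y) = A := by
  obtain ⟨γ, -, -, hγ, rfl⟩ := hA
  refine ⟨γ, Metric.continuousOn_iff.2 fun b hb ε hε => ⟨ε, hε, fun a ha hab => ?_⟩, rfl⟩
  rwa [hγ a ha b hb, ← Real.dist_eq]

theorem IsGeodesicSegment.isClosed (hA : IsGeodesicSegment x y A) : IsClosed A := by
  obtain ⟨γ, hγ, rfl⟩ := hA.exists_continuousOn
  exact (isCompact_Icc.image_of_continuousOn hγ).isClosed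

theorem IsGeodesicSegment.isPreconnected (hA : IsGeodesicSegment x y A) : IsPreconnected A := by
  obtain ⟨γ, hγ, rfl⟩ := hA.exists_continuousOn
  exact isPreconnected_Icc.image γ hγ

theorem IsGeodesicSegment.gromovProduct_le (hA : IsGeodesicSegment x y A) {m : X} (hm : m ∈ A)
    (o : X) : gromovProduct o x y ≤ dist o m := by
  unfold gromovProduct
  linarith [hA.dist_add_dist hm, dist_triangle o m x, dist_triangle o m y, dist_comm x m]

theorem IsGeodesicSpace.hasMidpoints (hX : IsGeodesicSpace X) : HasMidpoints X := by
  intro x y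
  obtain ⟨A, γ, h0, h1, hγ, -⟩ := hX x y
  have hd : 0 ≤ dist x y := dist_nonneg
  have hmid : dist x y / 2 ∈ Set.Icc 0 (dist x y) := ⟨by linarith, by linarith⟩
  have hleft := hγ 0 ⟨le_rfl, hd⟩ _ hmid
  have hright := hγ _ hmid _ ⟨hd, le_rfl⟩
  rw [h0, abs_of_nonpos (by linarith)] at hleft
  rw [h1, abs_of_nonpos (by linarith)] at hright
  exact ⟨γ (dist x y / 2), by linarith, by linarith⟩

/-- By connectedness, the side `A`, being covered by the closed sets `B` and `C`, meets `B ∩ C`. -/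
theorem HasThinTriangles.exists_mem_dist_eq_gromovProduct (hX : HasThinTriangles X 0) {o : X}
    {B C : Set X} (hA : IsGeodesicSegment x y A) (hB : IsGeodesicSegment y o B)
    (hC : IsGeodesicSegment o x C) : ∃ m ∈ A, dist o m = gromovProduct o x y := by
  have hsub : A ⊆ B ∪ C := fun p hp => by
    obtain ⟨q, hq, hpq⟩ := hX x y o A B C hA hB hC p hp
    rwa [dist_le_zero.1 hpq]
  obtain ⟨m, hmA, hmB, hmC⟩ := isPreconnected_closed_iff.1 hA.isPreconnected B C
    hB.isClosed hC.isClosed hsub ⟨y, hA.right_mem, hB.left_mem⟩ ⟨x, hA.left_mem, hC.right_mem⟩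
  refine ⟨m, hmA, ?_⟩
  unfold gromovProduct
  linarith [hA.dist_add_dist hmA, hB.dist_add_dist hmB, hC.dist_add_dist hmC, dist_comm x m,
    dist_comm y m, dist_comm m o, dist_comm y o]

theorem IsRealTree.isZeroHyperbolic (hX : IsRealTree X) : IsZeroHyperbolic X := by
  intro o x y z
  obtain ⟨hgeod, hthin⟩ := hX
  obtain ⟨A, hA⟩ := hgeod x z
  obtain ⟨B, hB⟩ := hgeod z o
  obtain ⟨C, hC⟩ := hgeod o x
  obtain ⟨B', hB'⟩ := hgeod z y
  obtain ⟨C', hC'⟩ := hgeod y x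
  obtain ⟨m, hm, hmd⟩ := hthin.exists_mem_dist_eq_gromovProduct hA hB hC
  obtain ⟨q, hq, hmq⟩ := hthin x z y A B' C' hA hB' hC' m hm
  obtain rfl := dist_le_zero.1 hmq
  rw [← hmd, gromovProduct_comm o x y, gromovProduct_comm o y z, min_le_iff]
  exact hq.symm.imp (hC'.gromovProduct_le · o) (hB'.gromovProduct_le · o)

end RealTree

/-! ### Groups of isometries -/

section Action

variable {X : Type*} [MetricSpace X] {Γ : Type*} [Group Γ] [MulAction Γ X] [IsIsometricSMul Γ X]

theorem dist_inv_smul_right (g : Γ) (x y : X) : dist x (g⁻¹ • y) = dist (g • x) y := by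
  rw [← dist_smul g x (g⁻¹ • y), smul_inv_smul]

theorem dist_inv_smul_left (g : Γ) (x y : X) : dist (g⁻¹ • x) y = dist x (g • y) := by
  rw [← dist_smul g (g⁻¹ • x) y, smul_inv_smul]

theorem gromovProduct_smul_add_gromovProduct_inv_smul (g : Γ) (p y : X) :
    gromovProduct p (g • y) (g • p) + gromovProduct p y (g⁻¹ • p) = dist p (g • p) := by
  rw [gromovProduct, gromovProduct, dist_smul, dist_inv_smul_right, dist_inv_smul_right,
    dist_comm (g • p) p, dist_comm (g • y) p, dist_comm y p]
  ring

theorem gromovProduct_smul (g : Γ) (o x y : X) :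
    gromovProduct (g • o) (g • x) (g • y) = gromovProduct o x y := by
  simp only [gromovProduct, dist_smul]

theorem IsMidpoint.smul {m x y : X} (h : IsMidpoint m x y) (g : Γ) :
    IsMidpoint (g • m) (g • x) (g • y) := by
  simpa only [IsMidpoint, dist_smul] using h

/-! ### Groups without hyperbolic elements -/

/-- No element of `Γ` has an axis in `X`: on a `0`-hyperbolic space with midpoints, an element `g`
fixes a point as soon as `dist x (g ^ 2 • x) ≤ dist x (g • x)` for some `x`, and translates an axis
otherwise. -/
def IsElliptic (Γ X : Type*) [MetricSpace X] [Group Γ] [MulAction Γ X] : Prop :=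
  ∀ (g : Γ) (x : X), dist x (g • g • x) ≤ dist x (g • x)

theorem IsElliptic.half_dist_le_gromovProduct_inv_smul (hΓ : IsElliptic Γ X) (h : Γ) (x : X) :
    dist x (h • x) / 2 ≤ gromovProduct x (h • x) (h⁻¹ • x) := by
  have hh := hΓ h x
  rw [gromovProduct, dist_inv_smul_right, dist_inv_smul_right, dist_comm (h • x) x,
    dist_comm _ x]
  linarith

/-- If this failed, then, as in Serre's lemma on products of elliptic isometries, `h • x`,
`h⁻¹ • x`, `(h⁻¹ * k) • x`, `(k⁻¹ * h) • x`, `k⁻¹ • x` and `k • x` would all lie in the same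
direction from `x`. -/
theorem IsElliptic.half_dist_le_gromovProduct (hX : IsZeroHyperbolic X) (hΓ : IsElliptic Γ X)
    {h k : Γ} {x : X} (hle : dist x (h • x) ≤ dist x (k • x)) :
    dist x (h • x) / 2 ≤ gromovProduct x (h • x) (k • x) := by
  by_contra! hlt
  have hsum (a b : Γ) : gromovProduct x (a⁻¹ • x) (a⁻¹ • b • x) =
      dist x (a • x) - gromovProduct x (a • x) (b • x) := by
    have hab := gromovProduct_smul_add_gromovProduct_inv_smul a⁻¹ x (b • x)
    rw [inv_inv, dist_inv_smul_right, dist_comm (a • x)] at hab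
    rw [gromovProduct_comm, gromovProduct_comm x (a • x)]
    linarith
  have h_inv := hΓ.half_dist_le_gromovProduct_inv_smul h x
  have k_inv : dist x (h • x) / 2 ≤ gromovProduct x (k⁻¹ • x) (k • x) := by
    rw [gromovProduct_comm]
    linarith [hΓ.half_dist_le_gromovProduct_inv_smul k x]
  have h_inv_k : dist x (h • x) / 2 ≤ gromovProduct x (h⁻¹ • x) (h⁻¹ • k • x) := by
    linarith [hsum h k]
  have k_inv_h : dist x (h • x) / 2 ≤ gromovProduct x (k⁻¹ • h • x) (k⁻¹ • x) := by
    rw [gromovProduct_comm]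
    linarith [hsum k h, gromovProduct_comm x (h • x) (k • x)]
  have h_inv_k_inv : dist x (h • x) / 2 ≤ gromovProduct x (h⁻¹ • k • x) (k⁻¹ • h • x) := by
    have hhk := hΓ.half_dist_le_gromovProduct_inv_smul (h⁻¹ * k) x
    rw [mul_inv_rev, inv_inv, mul_smul, mul_smul, dist_inv_smul_right] at hhk
    refine le_trans ?_ hhk
    unfold gromovProduct at hlt
    linarith
  exact hlt.not_ge <| hX.le_trans h_inv <| hX.le_trans h_inv_k <| hX.le_trans h_inv_k_inv <|
    hX.le_trans k_inv_h k_inv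

theorem IsElliptic.smul_midpoint (hX : IsZeroHyperbolic X) (hΓ : IsElliptic Γ X) {h : Γ} {x m : X}
    (hm : IsMidpoint m x (h • x)) : h • m = m := by
  refine (dist_le_zero.1 ((hX.dist_midpoint_le hm.symm (hm.smul h) ?_ ?_).trans_eq ?_)).symm
  · rw [dist_smul, dist_comm]
  · have hhx := hΓ h x
    rw [gromovProduct, dist_smul, dist_comm (h • x) x]
    linarith
  · rw [dist_smul, dist_comm, sub_self, zero_div]

theorem IsElliptic.dist_midpoint_le (hX : IsZeroHyperbolic X) (hΓ : IsElliptic Γ X) {h k : Γ}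
    {x m n : X} (hm : IsMidpoint m x (h • x)) (hn : IsMidpoint n x (k • x))
    (hle : dist x (h • x) ≤ dist x (k • x)) : dist m n ≤ (dist x (k • x) - dist x (h • x)) / 2 :=
  hX.dist_midpoint_le hm hn hle (hΓ.half_dist_le_gromovProduct hX hle)

theorem IsElliptic.dist_smul_midpoint_le (hX : IsZeroHyperbolic X) (hΓ : IsElliptic Γ X)
    {h k : Γ} {x m : X} (hm : IsMidpoint m x (k • x)) (hle : dist x (h • x) ≤ dist x (k • x)) :
    dist x (h • m) ≤ dist x m := by
  have hinv : dist x (h⁻¹ • x) = dist x (h • x) := by rw [dist_inv_smul_right, dist_comm]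
  have hkm : dist x (h⁻¹ • x) / 2 ≤ gromovProduct x (k • x) m := by
    rw [gromovProduct_comm, hm.gromovProduct_eq]
    linarith
  have hhm := hX.le_trans (hΓ.half_dist_le_gromovProduct hX (hinv.trans_le hle)) hkm
  rw [gromovProduct, dist_inv_smul_left] at hhm
  linarith

/-- The midpoint `q` of `m` and `h • m` is fixed by `h` and lies between `x` and `m`. As `m` is the
midpoint of `q` and `k • q`, its image `h • m` is the midpoint of `q` and `(h * k * h⁻¹) • q`;
but `k` and `h * k * h⁻¹` displace `q` equally. -/
theorem IsElliptic.smul_midpoint_of_le (hX : IsZeroHyperbolic X) (hM : HasMidpoints X)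
    (hΓ : IsElliptic Γ X) {h k : Γ} {x m : X} (hm : IsMidpoint m x (k • x))
    (hle : dist x (h • x) ≤ dist x (k • x)) : h • m = m := by
  obtain ⟨q, hq⟩ := hM m (h • m)
  have hhq : h • q = q := hΓ.smul_midpoint hX hq
  have hmq : dist m q = dist m (h • m) / 2 := hq.1
  have hxq : dist x q ≤ dist x m - dist m q := by
    have hqm : gromovProduct q m (h • m) = 0 :=
      gromovProduct_eq_zero_iff.2 (by rw [hq.1, hq.2, add_halves])
    have hmin := hX q m x (h • m)
    rw [hqm, min_le_iff] at hmin
    have hxhm := hΓ.dist_smul_midpoint_le hX hm hle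
    unfold gromovProduct at hmin
    rcases hmin with hmin | hmin <;>
      linarith [hq.2, dist_comm q m, dist_comm q x, dist_comm m x]
  have hmkq : dist m (k • q) = dist m q := by
    conv_lhs => rw [← hΓ.smul_midpoint hX hm, dist_smul]
  have hqkq : dist q (k • q) = 2 * dist m q := by
    refine le_antisymm (by linarith [dist_triangle_left q (k • q) m]) ?_
    have hxkx := dist_triangle4 x q (k • q) (k • x)
    rw [dist_smul, dist_comm q x] at hxkx
    linarith [hm.1]
  have hmid : IsMidpoint m q (k • q) := by
    constructor <;> linarith [dist_comm q m]
  have hconj : (h * k * h⁻¹) • q = h • k • q := by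
    rw [mul_smul, mul_smul, inv_smul_eq_iff.2 hhq.symm]
  have hmid' : IsMidpoint (h • m) q ((h * k * h⁻¹) • q) := by
    simpa only [hhq, hconj] using hmid.smul h
  have hdispl : dist q ((h * k * h⁻¹) • q) = dist q (k • q) := by
    rw [hconj]
    conv_lhs => rw [← hhq, dist_smul, hhq]
  refine (dist_le_zero.1 ((hΓ.dist_midpoint_le hX hmid hmid' hdispl.ge).trans_eq ?_)).symm
  rw [hdispl, sub_self, zero_div]

theorem IsElliptic.exists_almost_fixed (hX : IsZeroHyperbolic X) (hM : HasMidpoints X)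
    (hΓ : IsElliptic Γ X) (o : X) (r : ℝ) {δ : ℝ} (hδ : 0 < δ) :
    ∃ p : X, ∀ h : Γ, dist o (h • o) ≤ r → dist p (h • p) ≤ δ := by
  rcases lt_or_ge r 0 with hr | hr
  · exact ⟨o, fun h hh => absurd (hh.trans_lt hr) dist_nonneg.not_gt⟩
  set D : Set ℝ := {d | d ≤ r ∧ ∃ k : Γ, dist o (k • o) = d}
  have hne : D.Nonempty := ⟨0, hr, 1, by simp⟩
  have hbdd : BddAbove D := ⟨r, fun d hd => hd.1⟩
  obtain ⟨-, ⟨-, k, rfl⟩, hk⟩ := exists_lt_of_lt_csSup hne (sub_lt_self (sSup D) hδ)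
  obtain ⟨p, hp⟩ := hM o (k • o)
  refine ⟨p, fun h hh => ?_⟩
  rcases le_total (dist o (h • o)) (dist o (k • o)) with hle | hle
  · rw [hΓ.smul_midpoint_of_le hX hM hp hle, dist_self]
    exact hδ.le
  · obtain ⟨m, hm⟩ := hM o (h • o)
    have hpm := hΓ.dist_midpoint_le hX hp hm hle
    have hsup : dist o (h • o) ≤ sSup D := le_csSup hbdd ⟨hh, h, rfl⟩
    have htri := dist_triangle_right p (h • p) (h • m)
    rw [dist_smul, hΓ.smul_midpoint hX hm] at htri
    linarith

/-! ### Hyperbolic elements and ping-pong -/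

/-- `p` lies on the axis of `g`, that is, `g` translates a geodesic line through `p`; on a
`0`-hyperbolic space the three points `p`, `g • p` and `g • g • p` suffice to detect it. -/
def IsAxisPoint (g : Γ) (p : X) : Prop :=
  0 < dist p (g • p) ∧ dist p (g • g • p) = 2 * dist p (g • p)

theorem IsZeroHyperbolic.isAxisPoint_of_isMidpoint (hX : IsZeroHyperbolic X) {g : Γ} {x p : X}
    (hp : IsMidpoint p x (g • x)) (hg : dist x (g • x) < dist x (g • g • x)) :
    IsAxisPoint g p := by
  have hgp := hp.smul g
  have hgx : dist (g • x) (g • g • x) = dist x (g • x) := dist_smul ..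
  have hpos : 0 < dist p (g • p) := by
    linarith [dist_triangle4 x p (g • p) (g • g • x), hp.1, hgp.2]
  refine ⟨hpos, ?_⟩
  have hleft : 0 < gromovProduct (g • p) (g • x) p := by
    unfold gromovProduct
    linarith [hp.2, hgp.1, dist_comm (g • p) p, dist_comm (g • p) (g • x), dist_comm (g • x) p]
  have hright : 0 < gromovProduct (g • p) (g • g • p) (g • g • x) := by
    have hggp := hgp.smul g
    have hpp : dist (g • p) (g • g • p) = dist p (g • p) := dist_smul ..
    have hggx : dist (g • g • x) (g • g • g • x) = dist x (g • x) := by rw [dist_smul, dist_smul]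
    unfold gromovProduct
    linarith [hgp.2, hggp.1, dist_comm (g • g • p) (g • g • x)]
  have hmid : gromovProduct (g • p) (g • x) (g • g • x) = 0 :=
    gromovProduct_eq_zero_iff.2 (by rw [hgp.1, hgp.2, add_halves])
  have hzero : gromovProduct (g • p) p (g • g • p) = 0 :=
    (gromovProduct_nonneg _ _ _).antisymm' <| not_lt.1 fun h =>
      (hX.lt_trans hleft (hX.lt_trans h hright)).ne' hmid
  rw [← gromovProduct_eq_zero_iff.1 hzero, dist_smul, two_mul]

theorem IsAxisPoint.dist_pow_smul (hX : IsZeroHyperbolic X) {g : Γ} {p : X} (hp : IsAxisPoint g p)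
    (n : ℕ) : dist p (g ^ n • p) = n * dist p (g • p) := by
  suffices h : dist p (g ^ n • p) = n * dist p (g • p) ∧
      dist p (g ^ (n + 1) • p) = (n + 1 : ℕ) * dist p (g • p) from h.1
  induction n with
  | zero => simp
  | succ n ih =>
    refine ⟨ih.2, ?_⟩
    have hshift (k : ℕ) : dist (g • p) (g ^ (k + 1) • p) = dist p (g ^ k • p) := by
      rw [pow_succ', mul_smul, dist_smul]
    have hshift' : dist (g • g • p) (g ^ (n + 1 + 1) • p) = dist p (g ^ n • p) := by
      rw [pow_succ', mul_smul, dist_smul, hshift]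
    have hpg : dist (g • p) (g • g • p) = dist p (g • p) := dist_smul ..
    rw [← hX.dist_add_dist_of_overlap (b := g • p) (c := g • g • p), hshift, ih.2]
    · push_cast
      ring
    · rw [hpg, hp.2, two_mul]
    · rw [hpg, hshift, hshift', ih.1, ih.2]
      push_cast
      ring
    · exact hpg ▸ hp.1

theorem IsAxisPoint.dist_zpow_smul (hX : IsZeroHyperbolic X) {g : Γ} {p : X} (hp : IsAxisPoint g p)
    (n : ℤ) : dist p (g ^ n • p) = |(n : ℝ)| * dist p (g • p) := by
  obtain ⟨k, rfl | rfl⟩ := n.eq_nat_or_neg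
  · simpa using hp.dist_pow_smul hX k
  · simpa [dist_inv_smul_right, dist_comm] using hp.dist_pow_smul hX k

theorem IsAxisPoint.dist_zpow_smul_zpow_smul (hX : IsZeroHyperbolic X) {g : Γ} {p : X}
    (hp : IsAxisPoint g p) (a b : ℤ) :
    dist (g ^ a • p) (g ^ b • p) = |(b : ℝ) - a| * dist p (g • p) := by
  rw [← add_sub_cancel a b, zpow_add, mul_smul, dist_smul, hp.dist_zpow_smul hX]
  push_cast
  rw [add_sub_cancel_left]

theorem IsAxisPoint.dist_add_dist_zpow_smul (hX : IsZeroHyperbolic X) {g : Γ} {p : X}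
    (hp : IsAxisPoint g p) (j : ℤ) (k : ℕ) :
    dist p (g ^ j • p) + dist (g ^ j • p) (g ^ ((k + 1) * j) • p) =
      dist p (g ^ ((k + 1) * j) • p) := by
  rw [hp.dist_zpow_smul hX, hp.dist_zpow_smul hX, hp.dist_zpow_smul_zpow_smul hX, ← add_mul]
  push_cast
  rw [← sub_one_mul, add_sub_cancel_right, abs_mul, abs_mul,
    abs_of_nonneg (by positivity : 0 ≤ (k + 1 : ℝ)), Nat.abs_cast]
  ring

theorem IsAxisPoint.gromovProduct_zpow_smul_neg (hX : IsZeroHyperbolic X) {g : Γ} {p : X}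
    (hp : IsAxisPoint g p) (n : ℤ) : gromovProduct p (g ^ n • p) (g ^ (-n) • p) = 0 := by
  have habs : |(-n - n : ℝ)| = 2 * |(n : ℝ)| := by
    rw [← neg_add', abs_neg, ← two_mul, abs_mul, abs_two]
  rw [gromovProduct, hp.dist_zpow_smul hX, hp.dist_zpow_smul hX, hp.dist_zpow_smul_zpow_smul hX]
  push_cast
  rw [habs, abs_neg]
  ring

/-- The points `y` such that the geodesics from `p` to `y` and to `z` have a common initial segment
of length at least `K`. -/
def shadow (p : X) (K : ℝ) (z : X) : Set X := {y | K ≤ gromovProduct p y z}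

theorem IsZeroHyperbolic.disjoint_shadow (hX : IsZeroHyperbolic X) {p z w : X} {K : ℝ}
    (hzw : gromovProduct p z w < K) : Disjoint (shadow p K z) (shadow p K w) :=
  Set.disjoint_left.2 fun y hz hw =>
    hzw.not_ge (hX.le_trans ((gromovProduct_comm p z y).symm ▸ hz) hw)

theorem smul_compl_shadow_subset {g : Γ} {p : X} {K : ℝ} (hK : 2 * K ≤ dist p (g • p)) :
    g • (shadow p K (g⁻¹ • p))ᶜ ⊆ shadow p K (g • p) := by
  rintro - ⟨y, hy, rfl⟩
  have hsum := gromovProduct_smul_add_gromovProduct_inv_smul g p y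
  change K ≤ gromovProduct p (g • y) (g • p)
  linarith [not_le.1 (show ¬ K ≤ gromovProduct p y (g⁻¹ • p) from hy)]

theorem IsZeroHyperbolic.injective_lift_of_gromovProduct_lt {X : Type*} [MetricSpace X]
    (hX : IsZeroHyperbolic X) {ι Γ : Type u} [Nontrivial ι] [Group Γ] [MulAction Γ X]
    [IsIsometricSMul Γ X] {x : ι → Γ} {p : X} {K : ℝ} (hK : ∀ i, 2 * K ≤ dist p (x i • p))
    (hpos : Pairwise fun i j => gromovProduct p (x i • p) (x j • p) < K)
    (hneg : Pairwise fun i j => gromovProduct p ((x i)⁻¹ • p) ((x j)⁻¹ • p) < K)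
    (hmix : ∀ i j, gromovProduct p (x i • p) ((x j)⁻¹ • p) < K) :
    Function.Injective (FreeGroup.lift x) := by
  have hinv (i : ι) : 2 * K ≤ dist p ((x i)⁻¹ • p) := by
    rw [dist_inv_smul_right, dist_comm]
    exact hK i
  have hmem (i : ι) : x i • p ∈ shadow p K (x i • p) := by
    change K ≤ gromovProduct p (x i • p) (x i • p)
    rw [gromovProduct_self_right]
    linarith [hK i, dist_nonneg (x := p) (y := x i • p)]
  refine FreeGroup.injective_lift_of_ping_pong x
    (fun i => shadow p K (x i • p)) (fun i => shadow p K ((x i)⁻¹ • p))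
    (fun i => ⟨x i • p, hmem i⟩)
    (fun i j hij => hX.disjoint_shadow (hpos hij)) (fun i j hij => hX.disjoint_shadow (hneg hij))
    (fun i j => hX.disjoint_shadow (hmix i j)) (fun i => smul_compl_shadow_subset (hK i))
    fun i => ?_
  simpa only [Pi.inv_apply, inv_inv] using smul_compl_shadow_subset (hinv i)

/-! ### Large local orbits -/

/-- The elements of `Γ` displacing `o` by at most `r` do not keep finitely many points near finitely
many others: there is `ε > 0` such that one of these elements moves all the points of any given
finite set `P` at distance at least `ε` from any given finite set `F`. -/
def HasLargeLocalOrbits (Γ : Type*) {X : Type*} [MetricSpace X] [Group Γ] [MulAction Γ X]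
    (o : X) (r : ℝ) : Prop :=
  ∃ ε : ℝ, 0 < ε ∧ ∀ P F : Finset X,
    ∃ h : Γ, dist o (h • o) ≤ r ∧ ∀ p ∈ P, ∀ q ∈ F, ε ≤ dist (h • p) q

theorem HasLargeLocalOrbits.change_base {o : X} {r : ℝ} (hΓ : HasLargeLocalOrbits Γ o r) (p : X) :
    HasLargeLocalOrbits Γ p (r + 2 * dist o p) := by
  obtain ⟨ε, hε, hΓ⟩ := hΓ
  refine ⟨ε, hε, fun P F => ?_⟩
  obtain ⟨h, ho, hh⟩ := hΓ P F
  refine ⟨h, ?_, hh⟩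
  have hp := dist_triangle4 p o (h • o) (h • p)
  rw [dist_smul, dist_comm p o] at hp
  linarith

theorem HasLargeLocalOrbits.not_isElliptic (hX : IsZeroHyperbolic X) (hM : HasMidpoints X) {o : X}
    {r : ℝ} (hΓ : HasLargeLocalOrbits Γ o r) : ¬ IsElliptic Γ X := by
  intro hell
  obtain ⟨ε, hε, hΓ⟩ := hΓ
  obtain ⟨p, hp⟩ := hell.exists_almost_fixed hX hM o r (half_pos hε)
  obtain ⟨h, ho, hh⟩ := hΓ {p} {p}
  have hhp : ε ≤ dist p (h • p) := dist_comm p (h • p) ▸ hh p (by simp) p (by simp)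
  linarith [hp h ho]

theorem IsZeroHyperbolic.dist_add_dist_smul (hX : IsZeroHyperbolic X) {u : Γ} {p q a z : X} {r : ℝ}
    (hu : dist p (u • p) ≤ r) (hqa : dist p q + dist q a = dist p a) (hq : r < dist p q)
    (hz : r + dist p q < gromovProduct p (u • a) z) :
    dist p (u • q) + dist (u • q) z = dist p z := by
  have huqa : gromovProduct (u • q) (u • p) (u • a) = 0 :=
    gromovProduct_eq_zero_iff.2 (by simpa only [dist_smul] using hqa)
  have hup : 0 < gromovProduct (u • q) (u • p) p := by
    rw [gromovProduct, dist_smul, dist_comm q p, dist_comm (u • p) p]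
    linarith [dist_nonneg (x := u • q) (y := p)]
  have hpua : dist p (u • q) + dist (u • q) (u • a) = dist p (u • a) :=
    gromovProduct_eq_zero_iff.1 <| (gromovProduct_nonneg _ _ _).antisymm' <|
      not_lt.1 fun h => (hX.lt_trans hup h).ne' huqa
  have hpuq : dist p (u • q) ≤ r + dist p q := by
    linarith [dist_triangle p (u • p) (u • q), dist_smul u p q]
  have huq : gromovProduct p (u • q) (u • a) = dist p (u • q) := by
    unfold gromovProduct
    linarith
  have huqz := hX.le_trans huq.ge (hpuq.trans hz.le)
  unfold gromovProduct at huqz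
  linarith [dist_triangle p (u • q) z]

theorem HasLargeLocalOrbits.exists_gromovProduct_smul_le (hX : IsZeroHyperbolic X) {p : X}
    {r R : ℝ} (hΓ : HasLargeLocalOrbits Γ p r) (hR : r < R) {A : Finset X}
    (hA : ∀ a ∈ A, ∃ q, dist p q = R ∧ dist p q + dist q a = dist p a) (Z : Finset X) :
    ∃ u : Γ, dist p (u • p) ≤ r ∧ ∀ a ∈ A, ∀ z ∈ Z, gromovProduct p (u • a) z ≤ r + R := by
  classical
  obtain ⟨ε, hε, hΓ⟩ := hΓ
  choose! q hqR hqa using hA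
  obtain ⟨F, hF, hcov⟩ := Metric.totallyBounded_iff.1
    ((totallyBounded_biUnion Z.finite_toSet).2 fun z _ => hX.totallyBounded_between p z) ε hε
  obtain ⟨u, hu, huF⟩ := hΓ (A.image q) hF.toFinset
  refine ⟨u, hu, fun a ha z hz => not_lt.1 fun hlt => ?_⟩
  have huqz := hX.dist_add_dist_smul hu (hqa a ha) (by rwa [hqR a ha]) (by rwa [hqR a ha])
  obtain ⟨f, hf, hfd⟩ := Set.mem_iUnion₂.1 (hcov (Set.mem_biUnion (Finset.mem_coe.2 hz) huqz))
  exact (huF _ (Finset.mem_image_of_mem q ha) f (hF.mem_toFinset.2 hf)).not_gt hfd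

theorem HasLargeLocalOrbits.exists_seq_gromovProduct_smul_le (hX : IsZeroHyperbolic X) {p : X}
    {r R : ℝ} (hΓ : HasLargeLocalOrbits Γ p r) (hR : r < R) {A : Finset X}
    (hA : ∀ a ∈ A, ∃ q, dist p q = R ∧ dist p q + dist q a = dist p a) :
    ∃ t : ℕ → Γ, (∀ i, dist p (t i • p) ≤ r) ∧
      Pairwise fun i j => ∀ a ∈ A, ∀ b ∈ A, gromovProduct p (t i • a) (t j • b) ≤ r + R := by
  classical
  let Separated (s t : Γ) : Prop := ∀ a ∈ A, ∀ b ∈ A, gromovProduct p (s • a) (t • b) ≤ r + R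
  have : Std.Symm Separated :=
    ⟨fun s t hst a ha b hb => gromovProduct_comm p (s • b) (t • a) ▸ hst b hb a ha⟩
  refine exists_seq_of_forall_finset_exists' (fun t => dist p (t • p) ≤ r) Separated fun s _ => ?_
  obtain ⟨u, hu, huA⟩ := hΓ.exists_gromovProduct_smul_le hX hR hA
    (s.biUnion fun t => A.image (t • ·))
  refine ⟨u, hu, fun t ht a ha b hb => ?_⟩
  rw [gromovProduct_comm]
  exact huA b hb _ (Finset.mem_biUnion.2 ⟨t, ht, Finset.mem_image_of_mem _ ha⟩)

/-- Conjugates of a power of `g` by elements that send the axis of `g` in pairwise different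
directions play ping-pong, once that power is long enough. -/
theorem IsAxisPoint.injective_lift_conj {X : Type*} [MetricSpace X] (hX : IsZeroHyperbolic X)
    {ι Γ : Type u} [Nontrivial ι] [Group Γ] [MulAction Γ X] [IsIsometricSMul Γ X] {g : Γ} {p : X}
    (hp : IsAxisPoint g p) {r M : ℝ} {n : ℤ} {t : ι → Γ} (ht : ∀ i, dist p (t i • p) ≤ r)
    (hM : r ≤ M) (hn : 2 * M + 6 * r < |(n : ℝ)| * dist p (g • p))
    (hsep : Pairwise fun i j => ∀ a ∈ ({g ^ n • p, g ^ (-n) • p} : Set X),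
      ∀ b ∈ ({g ^ n • p, g ^ (-n) • p} : Set X), gromovProduct p (t i • a) (t j • b) ≤ M) :
    Function.Injective (FreeGroup.lift fun i => t i * g ^ n * (t i)⁻¹) := by
  have hconj (i : ι) (a : ℤ) : dist ((t i * g ^ a * (t i)⁻¹) • p) (t i • g ^ a • p) ≤ r := by
    rw [mul_smul, mul_smul, dist_smul, dist_smul, dist_inv_smul_left]
    exact ht i
  have hinv (i : ι) : (t i * g ^ n * (t i)⁻¹)⁻¹ = t i * g ^ (-n) * (t i)⁻¹ := by
    rw [conj_inv, zpow_neg]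
  have hclose {i j : ι} {a b : ℤ} (h : gromovProduct p (t i • g ^ a • p) (t j • g ^ b • p) ≤ M) :
      gromovProduct p ((t i * g ^ a * (t i)⁻¹) • p) ((t j * g ^ b * (t j)⁻¹) • p) <
        (|(n : ℝ)| * dist p (g • p) - 2 * r) / 2 := by
    refine (gromovProduct_le_add_dist _ _ _ (t i • g ^ a • p) (t j • g ^ b • p)).trans_lt ?_
    linarith [hconj i a, hconj j b]
  have hself (i : ι) : gromovProduct p (t i • g ^ n • p) (t i • g ^ (-n) • p) ≤ M := by
    refine (gromovProduct_le_add_dist_base p (t i • p) _ _).trans ?_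
    rw [gromovProduct_smul, hp.gromovProduct_zpow_smul_neg hX, zero_add]
    exact (ht i).trans hM
  refine hX.injective_lift_of_gromovProduct_lt (p := p) (fun i => ?_)
    (fun i j hij => hclose (hsep hij _ (.inl rfl) _ (.inl rfl))) (fun i j hij => ?_)
    fun i j => ?_
  · have htri := dist_triangle4_right (t i • p) (t i • g ^ n • p) p ((t i * g ^ n * (t i)⁻¹) • p)
    rw [dist_smul, hp.dist_zpow_smul hX, dist_comm (t i • p) p, dist_comm (t i • g ^ n • p)] at htri
    linarith [ht i, hconj i n]
  · simp only [hinv]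
    exact hclose (hsep hij _ (.inr rfl) _ (.inr rfl))
  · rw [hinv]
    rcases eq_or_ne i j with rfl | hij
    · exact hclose (hself i)
    · exact hclose (hsep hij _ (.inl rfl) _ (.inr rfl))

theorem injective_lift_of_injective_lift_ulift {ι Γ : Type*} [Group Γ] {x : ι → Γ}
    (hx : Function.Injective (FreeGroup.lift fun i : ULift.{u} ι => x i.down)) :
    Function.Injective (FreeGroup.lift x) := by
  have hcomp : FreeGroup.lift x =
      (FreeGroup.lift fun i : ULift.{u} ι => x i.down).comp (FreeGroup.map ULift.up) := by
    ext i
    simp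
  rw [hcomp, MonoidHom.coe_comp]
  exact hx.comp (FreeGroup.map_injective ULift.up_injective)

theorem HasLargeLocalOrbits.exists_injective_lift (hX : IsZeroHyperbolic X) (hM : HasMidpoints X)
    {o : X} {r : ℝ} (hΓ : HasLargeLocalOrbits Γ o r) :
    ∃ x : ℕ → Γ, Function.Injective (FreeGroup.lift x) := by
  classical
  obtain ⟨g, x₀, hg⟩ : ∃ (g : Γ) (x : X), dist x (g • x) < dist x (g • g • x) := by
    simpa only [IsElliptic, not_forall, not_le] using hΓ.not_isElliptic hX hM
  obtain ⟨p, hmid⟩ := hM x₀ (g • x₀)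
  have hp : IsAxisPoint g p := hX.isAxisPoint_of_isMidpoint hmid hg
  have hΓp := hΓ.change_base p
  generalize r + 2 * dist o p = D at hΓp
  obtain ⟨m, hm⟩ := exists_nat_gt (4 * |D| / dist p (g • p))
  rw [div_lt_iff₀ hp.1] at hm
  set R := m * dist p (g • p)
  have hR : D < R := by linarith [le_abs_self D, abs_nonneg D]
  have hbetween (j : ℤ) :
      dist p (g ^ j • p) + dist (g ^ j • p) (g ^ (4 * j) • p) = dist p (g ^ (4 * j) • p) := by
    simpa [three_add_one_eq_four] using hp.dist_add_dist_zpow_smul hX j 3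
  set A : Finset X := {g ^ (4 * m : ℤ) • p, g ^ (-(4 * m : ℤ)) • p} with hA
  have hAR : ∀ a ∈ A, ∃ q, dist p q = R ∧ dist p q + dist q a = dist p a := by
    simp only [hA, Finset.mem_insert, Finset.mem_singleton, forall_eq_or_imp, forall_eq]
    refine ⟨⟨g ^ (m : ℤ) • p, ?_, hbetween m⟩, ⟨g ^ (-m : ℤ) • p, ?_, ?_⟩⟩
    · simpa using hp.dist_zpow_smul hX m
    · simpa using hp.dist_zpow_smul hX (-m)
    · simpa only [mul_neg] using hbetween (-m)
  obtain ⟨t, ht, hsep⟩ := hΓp.exists_seq_gromovProduct_smul_le hX hR hAR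
  have hsep' := hsep.comp_of_injective ULift.down_injective
  refine ⟨fun i => t i * g ^ (4 * m : ℤ) * (t i)⁻¹, injective_lift_of_injective_lift_ulift <|
    hp.injective_lift_conj hX (t := t ∘ ULift.down) (M := D + R) (fun i => ht i.down) ?_ ?_ ?_⟩
  · linarith [abs_nonneg D]
  · push_cast
    rw [abs_mul, Nat.abs_ofNat, Nat.abs_cast]
    linarith [le_abs_self D]
  · simpa [hA, Function.onFun] using hsep'

end Action

/-! ### Growth of word balls -/

section Growth

open Real in
theorem eventually_mul_pow_floor_lt_pow_floor {A B ρ a b : ℝ} (hA : 0 ≤ A) (hB : 1 ≤ B)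
    (hρ : 1 ≤ ρ) (ha : 0 ≤ a) (hab : a * log B < b * log ρ) :
    ∀ᶠ t : ℝ in atTop, A * B ^ ⌊a * t⌋₊ < ρ ^ ⌊b * t⌋₊ := by
  have hB₀ : 0 < B := one_pos.trans_le hB
  have hρ₀ : 0 < ρ := one_pos.trans_le hρ
  have hexp : Tendsto (fun t => exp ((b * log ρ - a * log B) * t)) atTop atTop :=
    tendsto_exp_atTop.comp (tendsto_id.const_mul_atTop (sub_pos.2 hab))
  filter_upwards [hexp.eventually_gt_atTop (A * ρ), eventually_ge_atTop 0] with t ht ht₀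
  have hupper : B ^ ⌊a * t⌋₊ ≤ exp (log B * (a * t)) := by
    rw [← rpow_natCast, ← rpow_def_of_pos hB₀]
    exact rpow_le_rpow_of_exponent_le hB (Nat.floor_le (mul_nonneg ha ht₀))
  have hlower : exp (log ρ * (b * t)) ≤ ρ ^ (⌊b * t⌋₊ + 1) := by
    rw [← rpow_natCast, ← rpow_def_of_pos hρ₀]
    exact rpow_le_rpow_of_exponent_le hρ (by push_cast; exact (Nat.lt_floor_add_one _).le)
  refine lt_of_mul_lt_mul_right ?_ hρ₀.le
  calc A * B ^ ⌊a * t⌋₊ * ρ ≤ A * exp (log B * (a * t)) * ρ := by gcongr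
    _ = A * ρ * exp (log B * (a * t)) := by ring
    _ < exp ((b * log ρ - a * log B) * t) * exp (log B * (a * t)) := by gcongr
    _ = exp (log ρ * (b * t)) := by rw [← exp_add]; ring_nf
    _ ≤ ρ ^ ⌊b * t⌋₊ * ρ := hlower.trans_eq (pow_succ _ _)

theorem isCompact_pow {M : Type*} [Monoid M] [TopologicalSpace M] [ContinuousMul M] {S : Set M}
    (hS : IsCompact S) : ∀ n : ℕ, IsCompact (S ^ n)
  | 0 => by simp
  | n + 1 => by simpa only [pow_succ] using (isCompact_pow hS n).mul hS

variable {G : Type*} [Group G]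

theorem wordLength_inv {S : Set G} (hS : Subgroup.closure S = ⊤) (g : G) :
    wordLength S g⁻¹ = wordLength S g :=
  (wordLength_inv_le hS g).antisymm (by simpa using wordLength_inv_le hS g⁻¹)

theorem wordLength_le_mul {S T : Set G} (hS : Subgroup.closure S = ⊤)
    (hT : Subgroup.closure T = ⊤) {c : ℕ} (hc : ∀ t ∈ T, wordLength S t ≤ c) (g : G) :
    wordLength S g ≤ c * wordLength T g := by
  have hc' : ∀ t ∈ T ∪ T⁻¹, wordLength S t ≤ c := by
    rintro t (ht | ht)
    · exact hc t ht
    · exact wordLength_inv hS t ▸ hc t⁻¹ ht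
  suffices h : ∀ n, ∀ g ∈ (T ∪ T⁻¹) ^ n, wordLength S g ≤ c * n from
    h _ g (mem_pow_wordLength hT g)
  intro n
  induction n with
  | zero =>
    intro g hg
    rw [pow_zero, Set.mem_one] at hg
    simp [hg, wordLength_one]
  | succ n ih =>
    intro g hg
    rw [pow_succ] at hg
    obtain ⟨a, ha, b, hb, rfl⟩ := Set.mem_mul.1 hg
    calc wordLength S (a * b) ≤ wordLength S a + wordLength S b := wordLength_mul_le hS a b
      _ ≤ c * n + c := add_le_add (ih a ha) (hc' b hb)
      _ = c * (n + 1) := by ring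

theorem measure_le_card_mul_of_forall_exists_mem [MeasurableSpace G] [MeasurableMul G]
    (μ : Measure G) [μ.IsMulLeftInvariant] [μ.IsMulRightInvariant] {A B : Set G}
    {I : Finset (G × G)} (hA : ∀ h ∈ A, ∃ i ∈ I, i.2⁻¹ * (h * i.1) ∈ B) : μ A ≤ I.card * μ B := by
  have hcover : A ⊆ ⋃ i ∈ I, (· * i.1) ⁻¹' ((i.2⁻¹ * ·) ⁻¹' B) := fun h hh =>
    Set.mem_iUnion₂.2 (by simpa only [Set.mem_preimage, exists_prop] using hA h hh)
  calc μ A ≤ ∑ i ∈ I, μ ((· * i.1) ⁻¹' ((i.2⁻¹ * ·) ⁻¹' B)) :=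
        (measure_mono hcover).trans (measure_biUnion_finset_le _ _)
    _ = I.card * μ B := by
      simp only [measure_preimage_mul_right, measure_preimage_mul, Finset.sum_const, nsmul_eq_mul]

variable [TopologicalSpace G] [IsTopologicalGroup G]

theorem exists_finset_pow_succ_subset {V : Set G} (hV : IsCompact V) (hV₁ : V ∈ 𝓝 1) :
    ∃ E : Finset G, ∀ k : ℕ, V ^ (k + 1) ⊆ (E : Set G) ^ k * V := by
  classical
  obtain ⟨F, hF⟩ := compact_covered_by_mul_left_translates (hV.mul hV)
    ⟨1, mem_interior_iff_mem_nhds.2 hV₁⟩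
  have hVV : V * V ⊆ ((F⁻¹ : Finset G) : Set G) * V := by
    intro x hx
    obtain ⟨f, hf, hfx⟩ := Set.mem_iUnion₂.1 (hF hx)
    exact ⟨f⁻¹, by simpa using hf, f * x, hfx, inv_mul_cancel_left f x⟩
  refine ⟨F⁻¹, fun k => ?_⟩
  generalize F⁻¹ = E at hVV
  induction k with
  | zero => simp
  | succ k ih =>
    calc V ^ (k + 1 + 1) = V ^ (k + 1) * V := pow_succ _ _
      _ ⊆ (E : Set G) ^ k * V * V := Set.mul_subset_mul_right ih
      _ = (E : Set G) ^ k * (V * V) := mul_assoc _ _ _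
      _ ⊆ (E : Set G) ^ k * ((E : Set G) * V) := Set.mul_subset_mul_left hVV
      _ = (E : Set G) ^ (k + 1) * V := by rw [← mul_assoc, ← pow_succ]

/-- By Baire's theorem a ball of the word metric of `S` has interior, and finitely many of its
translates cover `T`. -/
theorem IsCompactGenerating.exists_wordLength_le_mul [T2Space G] [LocallyCompactSpace G]
    {S T : Set G} (hS : IsCompactGenerating S) (hT : IsCompactGenerating T) :
    ∃ c : ℕ, 0 < c ∧ ∀ g, wordLength S g ≤ c * wordLength T g := by
  have hSc : IsCompact (S ∪ S⁻¹) := hS.isCompact.union hS.isCompact.inv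
  obtain ⟨n, hn⟩ := nonempty_interior_of_iUnion_of_closed
    (fun n : ℕ => (isCompact_pow hSc n).isClosed)
    (Set.eq_univ_of_forall fun g => Set.mem_iUnion.2 (exists_mem_pow hS.closure_eq g))
  obtain ⟨F, hF⟩ := compact_covered_by_mul_left_translates hT.isCompact hn
  refine ⟨F.sup (wordLength S) + n + 1, Nat.succ_pos _,
    wordLength_le_mul hS.closure_eq hT.closure_eq fun t ht => ?_⟩
  obtain ⟨f, hf, hft⟩ := Set.mem_iUnion₂.1 (hF ht)
  calc wordLength S t = wordLength S (f⁻¹ * (f * t)) := by rw [inv_mul_cancel_left]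
    _ ≤ wordLength S f⁻¹ + wordLength S (f * t) := wordLength_mul_le hS.closure_eq _ _
    _ ≤ F.sup (wordLength S) + n :=
      add_le_add ((wordLength_inv hS.closure_eq f).trans_le (Finset.le_sup hf)) (wordLength_le hft)
    _ ≤ F.sup (wordLength S) + n + 1 := Nat.le_succ _

variable [MeasurableSpace G]

theorem IsCompactGenerating.exists_measure_wordBall_le [LocallyCompactSpace G] {S : Set G}
    (hS : IsCompactGenerating S) (μ : Measure G) [μ.IsHaarMeasure] :
    ∃ C B : ℝ, 0 ≤ C ∧ 1 ≤ B ∧ ∀ k : ℕ, μ (wordBall S k) ≤ ENNReal.ofReal (C * B ^ k) := by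
  classical
  obtain ⟨U, hU, hU₁⟩ := exists_compact_mem_nhds (1 : G)
  set V : Set G := (S ∪ S⁻¹) ∪ U
  have hV : IsCompact V := (hS.isCompact.union hS.isCompact.inv).union hU
  have hV₁ : V ∈ 𝓝 (1 : G) := mem_of_superset hU₁ Set.subset_union_right
  obtain ⟨E, hE⟩ := exists_finset_pow_succ_subset hV hV₁
  refine ⟨(μ V).toReal, E.card + 1, ENNReal.toReal_nonneg, by simp, fun k => ?_⟩
  have hball : wordBall S k ⊆ ⋃ a ∈ E ^ k, a • V := by
    intro g hg
    have hgV : g ∈ V ^ (k + 1) := Set.pow_subset_pow (n := k + 1) Set.subset_union_left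
      (mem_of_mem_nhds hV₁) (hg.trans k.le_succ) (mem_pow_wordLength hS.closure_eq g)
    obtain ⟨a, ha, v, hv, rfl⟩ := hE k hgV
    rw [← Finset.coe_pow] at ha
    exact Set.mem_biUnion (Finset.mem_coe.1 ha) ⟨v, hv, rfl⟩
  calc μ (wordBall S k) ≤ ∑ a ∈ E ^ k, μ (a • V) :=
        (measure_mono hball).trans (measure_biUnion_finset_le _ _)
    _ = (E ^ k).card * μ V := by simp [measure_smul]
    _ ≤ (E.card + 1) ^ k * μ V := by
      gcongr
      exact_mod_cast Finset.card_pow_le.trans (Nat.pow_le_pow_left E.card.le_succ k)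
    _ = ENNReal.ofReal ((μ V).toReal * (E.card + 1) ^ k) := by
      rw [mul_comm, ENNReal.ofReal_mul ENNReal.toReal_nonneg,
        ENNReal.ofReal_toReal hV.measure_lt_top.ne, ENNReal.ofReal_pow (by positivity),
        ENNReal.ofReal_add (by positivity) zero_le_one, ENNReal.ofReal_natCast, ENNReal.ofReal_one]

variable [BorelSpace G]

theorem IsUnimodular.isMulRightInvariant [LocallyCompactSpace G] (hG : IsUnimodular G)
    (μ : Measure G) [μ.IsHaarMeasure] [μ.Regular] : μ.IsMulRightInvariant where
  map_mul_right_eq_self g := by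
    have : (μ.map (· * g)).Regular := .map (Homeomorph.mulRight g)
    have hg : Measure.modularCharacterFun g = 1 := hG g
    rw [Measure.isMulLeftInvariant_eq_smul_of_regular (μ.map (· * g)) μ,
      ← Measure.modularCharacterFun_eq_haarScalarFactor, hg, one_smul]

/-- Otherwise the elements of `H` of length at most `t` would be covered by the sets
`q B p⁻¹`, for boundedly many pairs `(p, q)`, where `B` is the ball of radius `ε t`. By
unimodularity these sets all have the measure of `B`, which for small `ε` grows more slowly than
the ball of radius `t` of `H`. -/
theorem HasRelativeExponentialGrowth.exists_far [T2Space G] [LocallyCompactSpace G]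
    {H : Subgroup G} (hH : HasRelativeExponentialGrowth H) (hG : IsUnimodular G) {S : Set G}
    (hS : IsCompactGenerating S) :
    ∃ ε : ℝ, 0 < ε ∧ ∀ N : ℕ, ∀ᶠ t : ℝ in atTop, ∀ I : Finset (G × G), I.card ≤ N →
      ∃ h ∈ H, wordLength S h ≤ t ∧ ∀ i ∈ I, ε * t ≤ wordDist S (h * i.1) i.2 := by
  obtain ⟨-, T, μ, ρ, hT, hμ, hμr, hρ, hgrow⟩ := hH
  have := hG.isMulRightInvariant μ
  obtain ⟨c, hc, hcT⟩ := hS.exists_wordLength_le_mul hT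
  obtain ⟨C, B, hC, hB, hCB⟩ := hS.exists_measure_wordBall_le μ
  have hc' : (0 : ℝ) < c := Nat.cast_pos.2 hc
  obtain ⟨ε, hε, hεB⟩ :=
    exists_pos_mul_lt (mul_pos (inv_pos.2 hc') (Real.log_pos hρ)) (Real.log B)
  refine ⟨ε, hε, fun N => ?_⟩
  filter_upwards [eventually_mul_pow_floor_lt_pow_floor (A := N * C) (by positivity) hB hρ.le hε.le
    ((mul_comm _ _).trans_lt hεB), eventually_ge_atTop (c : ℝ)] with t ht htc I hI
  by_contra! hnear
  set j := ⌊(c : ℝ)⁻¹ * t⌋₊ with hj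
  set k := ⌊ε * t⌋₊
  have hj₁ : 1 ≤ j := by
    rwa [hj, Nat.one_le_floor_iff, inv_mul_eq_div, one_le_div hc']
  have hlength (h : G) (hh : h ∈ wordBall T j) : (wordLength S h : ℝ) ≤ t := by
    have hcj : (c * j : ℝ) ≤ t := by
      rw [← le_inv_mul_iff₀ hc']
      exact Nat.floor_le (mul_nonneg (inv_nonneg.2 hc'.le) (hc'.le.trans htc))
    exact le_trans (mod_cast (hcT h).trans (Nat.mul_le_mul_left c hh)) hcj
  have hmeasure : μ (H ∩ wordBall T j) ≤ I.card * μ (wordBall S k) := by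
    refine measure_le_card_mul_of_forall_exists_mem μ fun h hh => ?_
    obtain ⟨i, hi, hlt⟩ := hnear h hh.1 (hlength h hh.2)
    rw [wordDist_comm hS.closure_eq] at hlt
    exact ⟨i, hi, Nat.le_floor hlt.le⟩
  have hofReal : ENNReal.ofReal (ρ ^ j) ≤ ENNReal.ofReal (N * C * B ^ k) := calc
    ENNReal.ofReal (ρ ^ j) ≤ I.card * μ (wordBall S k) := (hgrow j hj₁).trans hmeasure
    _ ≤ N * ENNReal.ofReal (C * B ^ k) := by gcongr; exact hCB k
    _ = ENNReal.ofReal (N * C * B ^ k) := by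
      rw [mul_assoc, ENNReal.ofReal_mul N.cast_nonneg, ENNReal.ofReal_natCast]
  exact ht.not_ge ((ENNReal.ofReal_le_ofReal_iff (by positivity)).1 hofReal)

end Growth

/-! ### Sequences acting on asymptotic cones -/

section Cone

instance {M X : Type*} [PseudoMetricSpace X] [SMul M X] [IsIsometricSMul M X] :
    IsIsometricSMul M (SeparationQuotient X) where
  isometry_smul c := Isometry.of_dist_eq <|
    SeparationQuotient.surjective_mk.forall₂.2 fun x y => by
      rw [← SeparationQuotient.mk_smul, ← SeparationQuotient.mk_smul, SeparationQuotient.dist_mk,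
        SeparationQuotient.dist_mk, dist_smul]

theorem IsNonPrincipal.le_atTop {ω : Ultrafilter ℕ} (hω : IsNonPrincipal ω) :
    (ω : Filter ℕ) ≤ atTop := by
  rcases ω.le_cofinite_or_eq_pure with h | ⟨a, rfl⟩
  · rwa [Nat.cofinite_eq_atTop] at h
  · exact absurd (Ultrafilter.mem_pure.2 (Set.mem_singleton a)) (hω a)

variable {G : Type*} [Group G] {S : Set G}

theorem wordDist_mul_left (S : Set G) (g x y : G) :
    wordDist S (g * x) (g * y) = wordDist S x y := by
  rw [wordDist, wordDist, mul_inv_rev, mul_assoc, inv_mul_cancel_left]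

theorem wordDist_one_right (hS : Subgroup.closure S = ⊤) (g : G) :
    wordDist S g 1 = wordLength S g := by
  rw [wordDist, mul_one, wordLength_inv hS]

/-- The group of the sequences in `H` of word length `O(s n)`, which acts on the asymptotic cone of
`G` by termwise left multiplication. -/
def linearSequences (hS : Subgroup.closure S = ⊤) (H : Subgroup G) (s : ScalingSequence) :
    Subgroup (ℕ → H) where
  carrier := {h | ∃ C : ℝ, 0 < C ∧ ∀ n, (wordLength S (h n : G) : ℝ) ≤ C * s.seq n}
  one_mem' := ⟨1, one_pos, fun n => by simpa [wordLength_one] using (s.pos n).le⟩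
  mul_mem' := by
    rintro a b ⟨C, hC, ha⟩ ⟨D, hD, hb⟩
    refine ⟨C + D, add_pos hC hD, fun n => ?_⟩
    calc (wordLength S (a n * b n : G) : ℝ)
        ≤ wordLength S (a n : G) + wordLength S (b n : G) := mod_cast wordLength_mul_le hS _ _
      _ ≤ (C + D) * s.seq n := by linarith [ha n, hb n]
  inv_mem' := by
    rintro a ⟨C, hC, ha⟩
    exact ⟨C, hC, fun n => (congrArg Nat.cast (wordLength_inv hS (a n : G))).trans_le (ha n)⟩

variable {hS : Subgroup.closure S = ⊤} {H : Subgroup G} {s : ScalingSequence} {ω : Ultrafilter ℕ}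

theorem exists_mem_linearSequences {p : ℕ → H → Prop} {l : Filter ℕ}
    (hp : ∀ᶠ n in l, ∃ h : H, (wordLength S (h : G) : ℝ) ≤ s.seq n ∧ p n h) :
    ∃ h ∈ linearSequences hS H s,
      (∀ n, (wordLength S (h n : G) : ℝ) ≤ s.seq n) ∧ ∀ᶠ n in l, p n (h n) := by
  have hex (n : ℕ) : ∃ h : H, (wordLength S (h : G) : ℝ) ≤ s.seq n ∧
      ((∃ h : H, (wordLength S (h : G) : ℝ) ≤ s.seq n ∧ p n h) → p n h) := by
    by_cases hn : ∃ h : H, (wordLength S (h : G) : ℝ) ≤ s.seq n ∧ p n h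
    · exact hn.imp fun h hh => ⟨hh.1, fun _ => hh.2⟩
    · exact ⟨1, by simpa [wordLength_one] using (s.pos n).le, fun h => absurd h hn⟩
  choose h hle hph using hex
  exact ⟨h, ⟨1, one_pos, by simpa only [one_mul] using hle⟩, hle, hp.mono hph⟩

/-- The `n`-th term of a linear sequence, as an element of the group `G` rather than as a point of
its word metric. -/
def Precone.eval (x : Precone (WordSpace S hS) (WordSpace.base S hS) s ω) (n : ℕ) : G := x.1 n

/-- The constant sequence `1`, the base point of the cone. -/
def Precone.base (S : Set G) (hS : Subgroup.closure S = ⊤) (s : ScalingSequence)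
    (ω : Ultrafilter ℕ) : Precone (WordSpace S hS) (WordSpace.base S hS) s ω :=
  ⟨fun _ => WordSpace.base S hS, 1, one_pos, fun n => by simpa using (s.pos n).le⟩

theorem Precone.tendsto_wordDist (x y : Precone (WordSpace S hS) (WordSpace.base S hS) s ω) :
    Tendsto (fun n => wordDist S (x.eval n) (y.eval n) / s.seq n) ω (𝓝 (dist x y)) :=
  tendsto_ultraDist x y

instance : MulAction (linearSequences hS H s)
    (Precone (WordSpace S hS) (WordSpace.base S hS) s ω) where
  smul h x := ⟨fun n => ((h.1 n : G) * x.eval n : G), by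
    obtain ⟨C, hC, hh⟩ := h.2
    obtain ⟨D, hD, hx⟩ := x.2
    refine ⟨C + D, add_pos hC hD, fun n => ?_⟩
    calc wordDist S ((h.1 n : G) * x.eval n) 1
        ≤ wordDist S ((h.1 n : G) * x.eval n) ((h.1 n : G) * 1) + wordDist S ((h.1 n : G) * 1) 1 :=
          wordDist_triangle hS _ _ _
      _ = wordDist S (x.eval n) 1 + wordLength S (h.1 n : G) := by
        rw [wordDist_mul_left, mul_one, wordDist_one_right hS (h.1 n : G)]
      _ ≤ D * s.seq n + C * s.seq n := add_le_add (hx n) (hh n)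
      _ = (C + D) * s.seq n := by ring⟩
  one_smul x := Subtype.ext (funext fun n => one_mul (x.eval n))
  mul_smul g h x := Subtype.ext (funext fun n => mul_assoc (g.1 n : G) (h.1 n : G) (x.eval n))

theorem Precone.eval_smul (h : linearSequences hS H s)
    (x : Precone (WordSpace S hS) (WordSpace.base S hS) s ω) (n : ℕ) :
    (h • x).eval n = (h.1 n : G) * x.eval n := rfl

instance : IsIsometricSMul (linearSequences hS H s)
    (Precone (WordSpace S hS) (WordSpace.base S hS) s ω) where
  isometry_smul h := Isometry.of_dist_eq fun x y =>
    tendsto_nhds_unique (Precone.tendsto_wordDist (h • x) (h • y)) <| by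
      simpa only [Precone.eval_smul, wordDist_mul_left] using Precone.tendsto_wordDist x y

theorem Precone.dist_base_smul_base_le {h : linearSequences hS H s}
    (hh : ∀ n, (wordLength S (h.1 n : G) : ℝ) ≤ s.seq n) :
    dist (Precone.base S hS s ω) (h • Precone.base S hS s ω) ≤ 1 := by
  rw [dist_comm]
  refine le_of_tendsto' (Precone.tendsto_wordDist _ _) fun n => ?_
  rw [div_le_one (s.pos n), Precone.eval_smul]
  change wordDist S ((h.1 n : G) * 1) 1 ≤ s.seq n
  rw [mul_one, wordDist_one_right hS]
  exact hh n

theorem Precone.le_dist_smul {h : linearSequences hS H s}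
    {x y : Precone (WordSpace S hS) (WordSpace.base S hS) s ω} {ε : ℝ}
    (hxy : ∀ᶠ n in (ω : Filter ℕ),
      ε * s.seq n ≤ wordDist S ((h.1 n : G) * x.eval n) (y.eval n)) :
    ε ≤ dist (h • x) y := by
  refine ge_of_tendsto (Precone.tendsto_wordDist _ _) ?_
  filter_upwards [hxy] with n hn
  rwa [le_div_iff₀ (s.pos n), Precone.eval_smul]

variable [TopologicalSpace G] [IsTopologicalGroup G] [T2Space G] [LocallyCompactSpace G]
  [MeasurableSpace G] [BorelSpace G]

theorem HasRelativeExponentialGrowth.hasLargeLocalOrbits (hH : HasRelativeExponentialGrowth H)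
    (hG : IsUnimodular G) (hSc : IsCompact S) (hω : IsNonPrincipal ω) :
    HasLargeLocalOrbits (linearSequences hS H s)
      (SeparationQuotient.mk (Precone.base S hS s ω)) 1 := by
  classical
  obtain ⟨ε, hε, hfar⟩ := hH.exists_far hG ⟨hSc, hS⟩
  refine ⟨ε, hε, fun P F => ?_⟩
  have hrep := Function.rightInverse_surjInv (SeparationQuotient.surjective_mk
    (X := Precone (WordSpace S hS) (WordSpace.base S hS) s ω))
  set rep := Function.surjInv (SeparationQuotient.surjective_mk
    (X := Precone (WordSpace S hS) (WordSpace.base S hS) s ω))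
  have hexists : ∀ᶠ n in (ω : Filter ℕ), ∃ h : H, (wordLength S (h : G) : ℝ) ≤ s.seq n ∧
      ∀ p ∈ P, ∀ q ∈ F, ε * s.seq n ≤ wordDist S (h * (rep p).eval n) ((rep q).eval n) := by
    filter_upwards [(s.tendsto.mono_left hω.le_atTop).eventually (hfar (P ×ˢ F).card)] with n hn
    obtain ⟨h, hhH, hle, hh⟩ :=
      hn ((P ×ˢ F).image fun i => ((rep i.1).eval n, (rep i.2).eval n)) Finset.card_image_le
    rw [Finset.forall_mem_image] at hh
    exact ⟨⟨h, hhH⟩, hle, fun p hp q hq => @hh (p, q) (Finset.mk_mem_product hp hq)⟩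
  obtain ⟨h, hhs, hle, hhfar⟩ := exists_mem_linearSequences (hS := hS) hexists
  refine ⟨⟨h, hhs⟩, Precone.dist_base_smul_base_le hle, fun p hp q hq => ?_⟩
  rw [← hrep p, ← hrep q]
  exact Precone.le_dist_smul (hhfar.mono fun n hn => hn p hp q hq)

end Cone

/-! ### Laws -/

theorem SatisfiesLaw.pi {Γ : Type*} [Group Γ] (hΓ : SatisfiesLaw Γ) (ι : Type*) :
    SatisfiesLaw (ι → Γ) := by
  obtain ⟨n, w, hw, hlaw⟩ := hΓ
  refine ⟨n, w, hw, fun g => funext fun i => ?_⟩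
  have hcomp : (Pi.evalMonoidHom (fun _ : ι => Γ) i).comp (FreeGroup.lift g) =
      FreeGroup.lift fun j => g j i := by
    ext j
    simp
  exact (DFunLike.congr_fun hcomp w).trans (hlaw _)

theorem SatisfiesLaw.of_injective {Γ Γ' : Type*} [Group Γ] [Group Γ'] (hΓ : SatisfiesLaw Γ)
    (f : Γ' →* Γ) (hf : Function.Injective f) : SatisfiesLaw Γ' := by
  obtain ⟨n, w, hw, hlaw⟩ := hΓ
  refine ⟨n, w, hw, fun g => hf ?_⟩
  have hcomp : f.comp (FreeGroup.lift g) = FreeGroup.lift (f ∘ g) := by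
    ext j
    simp
  rw [map_one]
  exact (DFunLike.congr_fun hcomp w).trans (hlaw _)

theorem not_satisfiesLaw_of_injective_lift {Γ : Type*} [Group Γ] {x : ℕ → Γ}
    (hx : Function.Injective (FreeGroup.lift x)) : ¬ SatisfiesLaw Γ := by
  rintro ⟨n, w, hw, hlaw⟩
  have hcomp : (FreeGroup.lift x).comp (FreeGroup.map Fin.val) =
      FreeGroup.lift fun i : Fin n => x i := by
    ext i
    simp
  have hone : FreeGroup.lift x (FreeGroup.map Fin.val w) = 1 :=
    (DFunLike.congr_fun hcomp w).trans (hlaw _)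
  exact hw <| FreeGroup.map_injective Fin.val_injective <| hx <| by rw [hone, map_one, map_one]

end LacunaryHyp

end

theorem mainTheorem3_general {G : Type*} [Group G] [TopologicalSpace G] [IsTopologicalGroup G]
    [T2Space G] [LocallyCompactSpace G] [MeasurableSpace G] [BorelSpace G]
    (hG : LacunaryHyp.IsLacunaryHyperbolic G) (hGu : LacunaryHyp.IsUnimodular G) (H : Subgroup G)
    (hHg : LacunaryHyp.HasRelativeExponentialGrowth H) :
    ¬ LacunaryHyp.SatisfiesLaw H := by
  intro hlaw
  obtain ⟨S, hS, s, ω, hω, htree⟩ := hG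
  have horbits := hHg.hasLargeLocalOrbits (hS := hS.closure_eq) (s := s) hGu hS.isCompact hω
  obtain ⟨x, hx⟩ := horbits.exists_injective_lift htree.isZeroHyperbolic htree.1.hasMidpoints
  have hlaw_seq := (hlaw.pi ℕ).of_injective
    (LacunaryHyp.linearSequences hS.closure_eq H s).subtype (Subgroup.subtype_injective _)
  exact LacunaryHyp.not_satisfiesLaw_of_injective_lift hx hlaw_seq

theorem mainTheorem3 {G : Type*} [Group G] [TopologicalSpace G] [IsTopologicalGroup G]
    [T2Space G] [LocallyCompactSpace G] [MeasurableSpace G] [BorelSpace G]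
    (hG : LacunaryHyp.IsLacunaryHyperbolic G)
    (hGu : LacunaryHyp.IsUnimodular G)
    (H : Subgroup G)
    (hHc : LacunaryHyp.IsCompactlyGenerated H)
    (hHg : LacunaryHyp.HasRelativeExponentialGrowth H)
    (hHZ : ¬ LacunaryHyp.HasDiscreteCocompactZ H) :
    ¬ LacunaryHyp.SatisfiesLaw H :=
  mainTheorem3_general hG hGu H hHg
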